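/- Let $0<\beta<1$ and let $p=p(N)\in(0,1]$ be such that $pN\to\infty$ as $N\to\infty$. For each $N$ let $(\varepsilon_{i,j})_{i,j=1}^N$ be independent random variables with $\mathbb P[\varepsilon_{i,j}=1]=p$ and $\mathbb P[\varepsilon_{i,j}=0]=1-p$ (the edge indicators of a directed Erdős–Rényi graph $G(N,p)$ on $\{1,\dots,N\}$, loops $i=j$ allowed). For $\sigma\in\{-1,+1\}^N$ put $$H(\sigma)=-\frac1{2Np}\sum_{i,j=1}^N\varepsilon_{i,j}\sigma_i\sigma_j,\qquad Z_N(\beta)=\sum_{\sigma\in\{-1,+1\}^N}e^{-\beta H(\sigma)},$$ and let $L_N$ be the random probability measure on $\mathbb R$ $$L_N=\frac1{Z_N(\beta)}\sum_{\sigma\in\{-1,+1\}^N}e^{-\beta H(\sigma)}\,\delta_{\frac1{\sqrt N}\sum_{i=1}^N\sigma_i}.$$ For probability measures $\mu_1,\mu_2$ on $\mathbb R$ let $$d_L(\mu_1,\mu_2)=\inf\{\varepsilon>0:\ \mu_1(-\infty,t-\varepsilon]-\varepsilon\le\mu_2(-\infty,t]\le\mu_1(-\infty,t+\varepsilon]+\varepsilon\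 \text{ for all }t\in\mathbb R\}$$ be the Lévy metric, and let $\mathfrak N_{0,1/(1-\beta)}$ be the normal distribution with mean $0$ and variance $1/(1-\beta)$. Then $L_N$ converges in probability to $\mathfrak N_{0,1/(1-\beta)}$; that is, for every $\delta>0$, $$\lim_{N\to\infty}\mathbb P\big[d_L(L_N,\mathfrak N_{0,1/(1-\beta)})>\delta\big]=0.$$ -/

import Mathlib

open MeasureTheory ProbabilityTheory Filter Topology

noncomputable section

namespace DiluteIsing

/-- The family `ε i j` (`i, j` ranging over the `N` vertices, the case `i = j` being allowed)
consists of the edge indicators of a directed Erdős–Rényi graph `G(N, p)` defined on the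
probability space `(Ω, P)`: they are independent random variables with
`P[ε i j = 1] = p` and `P[ε i j = 0] = 1 - p`. -/
structure IsDirectedErdosRenyi {Ω : Type*} [MeasurableSpace Ω] (P : Measure Ω) {N : ℕ} (p : ℝ)
    (ε : Fin N → Fin N → Ω → ℝ) : Prop where
  measurable : ∀ i j, Measurable (ε i j)
  prob_one : ∀ i j, P.real {ω | ε i j ω = 1} = p
  prob_zero : ∀ i j, P.real {ω | ε i j ω = 0} = 1 - p
  indep : iIndepFun (fun (e : Fin N × Fin N) (ω : Ω) => ε e.1 e.2 ω) P

/-- Spin configurations `σ ∈ {-1, +1}^N`; the units of `ℤ` are exactly `1` and `-1`. -/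
abbrev Config (N : ℕ) : Type := Fin N → ℤˣ

/-- The real number `σ_i ∈ {-1, +1}`. -/
def spin {N : ℕ} (σ : Config N) (i : Fin N) : ℝ := ((σ i : ℤ) : ℝ)

/-- The Hamiltonian `H(σ) = -(1 / (2 N p)) ∑_{i,j} ε_{ij} σ_i σ_j`, for a fixed realization
`a = (ε_{ij})` of the edge indicators. -/
def hamiltonian {N : ℕ} (p : ℝ) (a : Fin N → Fin N → ℝ) (σ : Config N) : ℝ :=
  -(1 / (2 * (N : ℝ) * p)) * ∑ i, ∑ j, a i j * spin σ i * spin σ j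

/-- The partition function `Z_N(β) = ∑_σ exp(-β H(σ))`. -/
def partitionFunction {N : ℕ} (β p : ℝ) (a : Fin N → Fin N → ℝ) : ℝ :=
  ∑ σ : Config N, Real.exp (-β * hamiltonian p a σ)

/-- The Gibbs weight `μ_β(σ) = exp(-β H(σ)) / Z_N(β)`. -/
def gibbsWeight {N : ℕ} (β p : ℝ) (a : Fin N → Fin N → ℝ) (σ : Config N) : ℝ :=
  Real.exp (-β * hamiltonian p a σ) / partitionFunction β p a

/-- The rescaled magnetization `N^{-1/2} ∑_i σ_i`. -/
def scaledMagnetization {N : ℕ} (σ : Config N) : ℝ :=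
  1 / Real.sqrt (N : ℝ) * ∑ i, spin σ i

/-- The measure `L_N = Z_N(β)⁻¹ ∑_σ exp(-β H(σ)) δ_{N^{-1/2} ∑_i σ_i}` on `ℝ`. -/
def magnetizationMeasure {N : ℕ} (β p : ℝ) (a : Fin N → Fin N → ℝ) : Measure ℝ :=
  ∑ σ : Config N,
    ENNReal.ofReal (gibbsWeight β p a σ) • Measure.dirac (scaledMagnetization σ)

lemma partitionFunction_pos {N : ℕ} (β p : ℝ) (a : Fin N → Fin N → ℝ) :
    0 < partitionFunction β p a :=
  Finset.sum_pos (fun _ _ => Real.exp_pos _) Finset.univ_nonempty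

lemma gibbsWeight_nonneg {N : ℕ} (β p : ℝ) (a : Fin N → Fin N → ℝ) (σ : Config N) :
    0 ≤ gibbsWeight β p a σ :=
  div_nonneg (Real.exp_pos _).le (partitionFunction_pos β p a).le

lemma sum_gibbsWeight {N : ℕ} (β p : ℝ) (a : Fin N → Fin N → ℝ) :
    ∑ σ : Config N, gibbsWeight β p a σ = 1 := by
  unfold gibbsWeight
  rw [← Finset.sum_div]
  exact div_self (partitionFunction_pos β p a).ne'

instance isProbabilityMeasure_magnetizationMeasure {N : ℕ} (β p : ℝ) (a : Fin N → Fin N → ℝ) :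
    IsProbabilityMeasure (magnetizationMeasure β p a) := by
  constructor
  simp only [magnetizationMeasure, Measure.coe_finsetSum, Finset.sum_apply, Measure.smul_apply,
    measure_univ, smul_eq_mul, mul_one]
  rw [← ENNReal.ofReal_sum_of_nonneg (fun σ _ => gibbsWeight_nonneg β p a σ),
    sum_gibbsWeight, ENNReal.ofReal_one]

/-- `L_N` as an element of the space of probability measures on `ℝ`: the law of
`N^{-1/2} ∑_i σ_i` under the Gibbs measure with edge indicators `a`. -/
def magnetizationLaw {N : ℕ} (β p : ℝ) (a : Fin N → Fin N → ℝ) : ProbabilityMeasure ℝ :=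
  ⟨magnetizationMeasure β p a, inferInstance⟩

/-- The normal distribution with mean `0` and variance `v` (for `v ≥ 0`). -/
def centeredNormal (v : ℝ) : ProbabilityMeasure ℝ :=
  ⟨gaussianReal 0 (Real.toNNReal v), inferInstance⟩

/-- The Lévy metric: the infimum of the `ε > 0` such that
`μ₁(-∞, t - ε] - ε ≤ μ₂(-∞, t] ≤ μ₁(-∞, t + ε] + ε` for all real `t`. -/
def levyDist (μ₁ μ₂ : ProbabilityMeasure ℝ) : ℝ :=
  sInf {ε : ℝ | 0 < ε ∧ ∀ t : ℝ,
    (μ₁ : Measure ℝ).real (Set.Iic (t - ε)) - ε ≤ (μ₂ : Measure ℝ).real (Set.Iic t) ∧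
    (μ₂ : Measure ℝ).real (Set.Iic t) ≤ (μ₁ : Measure ℝ).real (Set.Iic (t + ε)) + ε}

end DiluteIsing

end

noncomputable section

namespace DiluteIsing

/-! The dilute model is compared with its annealed version, which is a Curie–Weiss model. With t =
tanh(β/(2Np)), each edge factor of the Gibbs weight is a factor free of σ times 1 + t·ε_{ij}σ_iσ_j
(`exp_neg_mul_hamiltonian`), so the Gibbs measure is the normalized `edgeWeight`. By independence
its expectation is ∏(1 + ptσ_iσ_j), a Curie–Weiss weight at inverse temperature 2N·artanh(pt), which
tends to β because pN → ∞.

The random sums concentrate by a second moment argument. The correlation of the weights of σ and τ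
exceeds the product of their means by a factor of at most exp(qR² + r), with R the overlap
(`integral_edgeWeight_mul_le`). Since qN → 0 and r → 0, and R²/N has bounded small exponential
moments under two independent Curie–Weiss copies at high temperature
(`exists_sum_sum_exp_overlap_le`), the relative variance vanishes. Chebyshev, applied to the
partition function and to its restriction to an event, shows that the Gibbs probability of the event
is close to the Curie–Weiss one (`measure_lt_abs_sub_curieWeiss_le`).

The Curie–Weiss central limit theorem for β < 1 follows from the Hubbard–Stratonovich transform and
characteristic functions (`tendsto_curieWeissLaw`). Control of the distribution functions at
finitely many points then bounds the Lévy distance (`exists_finset_levyDist_le`). -/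

/-! ### Central limit theorem for the Curie–Weiss model. -/

/-- The total magnetization `∑ i, σ_i`. -/
def totalSpin {N : ℕ} (σ : Config N) : ℝ := ∑ i, spin σ i

lemma spin_eq_one_or {N : ℕ} (σ : Config N) (i : Fin N) : spin σ i = 1 ∨ spin σ i = -1 := by
  rcases Int.units_eq_one_or (σ i) with h | h <;> simp [spin, h]

lemma sum_spin_mul_spin {N : ℕ} (σ : Config N) :
    ∑ i, ∑ j, spin σ i * spin σ j = totalSpin σ ^ 2 := by
  rw [sq, totalSpin, Finset.sum_mul_sum]

lemma sum_cexp_mul_totalSpin {N : ℕ} (θ : ℂ) :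
    ∑ σ : Config N, Complex.exp (θ * totalSpin σ) = (2 * Complex.cosh θ) ^ N := by
  have h : ∑ u : ℤˣ, Complex.exp (θ * ((u : ℤ) : ℝ)) = 2 * Complex.cosh θ := by
    have hu : (Finset.univ : Finset ℤˣ) = {1, -1} := rfl
    rw [hu, Finset.sum_pair (by decide), Complex.two_cosh]
    simp
  calc ∑ σ : Config N, Complex.exp (θ * totalSpin σ)
      = ∑ σ : Config N, ∏ i, Complex.exp (θ * ((σ i : ℤ) : ℝ)) := by
        refine Finset.sum_congr rfl fun σ _ => ?_
        rw [← Complex.exp_sum, totalSpin, Complex.ofReal_sum, Finset.mul_sum]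
        rfl
    _ = ∏ _i : Fin N, ∑ u : ℤˣ, Complex.exp (θ * ((u : ℤ) : ℝ)) :=
        (Fintype.prod_sum fun (_ : Fin N) (u : ℤˣ) => Complex.exp (θ * ((u : ℤ) : ℝ))).symm
    _ = _ := by rw [Finset.prod_congr rfl fun _ _ => h]; simp

lemma tendsto_sqrt_natCast : Tendsto (fun n : ℕ => √(n : ℝ)) atTop atTop :=
  Real.tendsto_sqrt_atTop.comp tendsto_natCast_atTop_atTop

/-- Since cosh(2w) - 1 = 2 sinh² w and sinh w = w·φ(w) with φ continuous and φ(0) = 1,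
n(cosh(u_n/√n) - 1) → v²/2. The limit (1 + c_n/n)^n → e^c concludes. -/
lemma tendsto_cosh_div_sqrt_pow {u : ℕ → ℂ} {v : ℂ} (hu : Tendsto u atTop (𝓝 v)) :
    Tendsto (fun n : ℕ => Complex.cosh (u n / (√(n : ℝ) : ℝ)) ^ n) atTop
      (𝓝 (Complex.exp (v ^ 2 / 2))) := by
  have hφ : ContinuousAt (dslope Complex.sinh 0) 0 :=
    continuousAt_dslope_same.2 Complex.differentiable_sinh.differentiableAt
  have hφ0 : dslope Complex.sinh 0 0 = 1 := by
    rw [dslope_same, (Complex.hasDerivAt_sinh 0).deriv, Complex.cosh_zero]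
  have hw : Tendsto (fun n : ℕ => u n / (√(n : ℝ) : ℝ) / 2) atTop (𝓝 0) := by
    have h1 : Tendsto (fun n : ℕ => (((√(n : ℝ))⁻¹ : ℝ) : ℂ)) atTop (𝓝 0) := by
      have := (Complex.continuous_ofReal.tendsto 0).comp
        (tendsto_inv_atTop_zero.comp tendsto_sqrt_natCast)
      simpa [Function.comp_def] using this
    have h2 := (hu.mul h1).div_const 2
    simpa [div_eq_mul_inv] using h2
  have hφw : Tendsto (fun n : ℕ => dslope Complex.sinh 0 (u n / (√(n : ℝ) : ℝ) / 2)) atTop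
      (𝓝 1) := by
    have := hφ.tendsto.comp hw
    rwa [hφ0] at this
  have key : Tendsto (fun n : ℕ => (n : ℂ) * (Complex.cosh (u n / (√(n : ℝ) : ℝ)) - 1)) atTop
      (𝓝 (v ^ 2 / 2)) := by
    have hlim : Tendsto (fun n : ℕ => (u n) ^ 2 / 2 *
        (dslope Complex.sinh 0 (u n / (√(n : ℝ) : ℝ) / 2)) ^ 2) atTop (𝓝 (v ^ 2 / 2 * 1 ^ 2)) :=
      ((hu.pow 2).div_const 2).mul (hφw.pow 2)
    rw [one_pow, mul_one] at hlim
    refine hlim.congr' ?_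
    filter_upwards [eventually_gt_atTop 0] with n hn
    set w : ℂ := u n / (√(n : ℝ) : ℝ) / 2 with hwdef
    have hs : ((√(n : ℝ) : ℝ) : ℂ) ≠ 0 := by
      have : (0 : ℝ) < √(n : ℝ) := Real.sqrt_pos.2 (by exact_mod_cast hn)
      exact_mod_cast this.ne'
    have hs2 : ((√(n : ℝ) : ℝ) : ℂ) ^ 2 = n := by
      rw [← Complex.ofReal_pow, Real.sq_sqrt (by positivity)]; simp
    have hun : u n = 2 * w * (√(n : ℝ) : ℝ) := by
      rw [hwdef]; field_simp
    have hsl : w * dslope Complex.sinh 0 w = Complex.sinh w := by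
      have := sub_smul_dslope Complex.sinh 0 w
      simpa [Function.comp_def] using this
    have hc : Complex.cosh (u n / (√(n : ℝ) : ℝ)) - 1 = 2 * Complex.sinh w ^ 2 := by
      have : u n / (√(n : ℝ) : ℝ) = 2 * w := by rw [hwdef]; ring
      rw [this, Complex.cosh_two_mul, Complex.cosh_sq]; ring
    rw [hc, ← hsl, hun, ← hs2]; ring
  simpa using Complex.tendsto_one_add_pow_exp_of_tendsto key

lemma norm_cosh_le (z : ℂ) : ‖Complex.cosh z‖ ≤ Real.cosh z.re := by
  rw [Complex.cosh, Real.cosh_eq, norm_div, Complex.norm_ofNat]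
  gcongr
  refine (norm_add_le _ _).trans_eq ?_
  simp [Complex.norm_exp]

lemma integral_cexp_neg_sq_div_two_add (a : ℂ) :
    ∫ z : ℝ, Complex.exp (-(z : ℂ) ^ 2 / 2) * Complex.exp (a * z) =
      ((Real.pi : ℂ) / (1 / 2)) ^ (1 / 2 : ℂ) * Complex.exp (a ^ 2 / 2) := by
  have h := integral_cexp_quadratic (b := -(1 / 2)) (by norm_num) a 0
  rw [neg_neg] at h
  convert! h using 2
  · ext z
    rw [← Complex.exp_add]; congr 1; ring
  · congr 1; ring

/-- The integral over `N` fair spins of `exp (b S² / (2N) + i θ S / √N)`, the unnormalized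
characteristic function of the rescaled magnetization in the Curie–Weiss model. -/
def curieWeissTransform (N : ℕ) (b θ : ℝ) : ℂ :=
  (∑ σ : Config N, Complex.exp ((b * (totalSpin σ) ^ 2 / (2 * N) : ℝ) +
    (θ * (totalSpin σ / √N) : ℝ) * Complex.I)) / 2 ^ N

/-- The square in the exponent is linearized by e^{a²/2} = E[e^{aZ}] for a standard Gaussian Z. The
sum over σ then factors over sites into a power of cosh. The constant on the left is √(2π). -/
lemma hubbardStratonovich {N : ℕ} {b : ℝ} (hb : 0 ≤ b) (θ : ℝ) :
    ((Real.pi : ℂ) / (1 / 2)) ^ (1 / 2 : ℂ) * curieWeissTransform N b θ =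
      ∫ z : ℝ, Complex.exp (-(z : ℂ) ^ 2 / 2) *
        Complex.cosh ((√b * z + θ * Complex.I) / (√(N : ℝ) : ℝ)) ^ N := by
  have h2 : ∀ σ : Config N, ((Real.pi : ℂ) / (1 / 2)) ^ (1 / 2 : ℂ) *
      Complex.exp ((b * (totalSpin σ) ^ 2 / (2 * N) : ℝ) +
        (θ * (totalSpin σ / √N) : ℝ) * Complex.I) =
      ∫ z : ℝ, Complex.exp (-(z : ℂ) ^ 2 / 2) *
        Complex.exp ((√b * z + θ * Complex.I) / (√(N : ℝ) : ℝ) * totalSpin σ) := by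
    intro σ
    have h := integral_cexp_neg_sq_div_two_add ((√b / √(N : ℝ) * totalSpin σ : ℝ) : ℂ)
    have e1 : (((√b / √(N : ℝ) * totalSpin σ : ℝ) : ℂ)) ^ 2 / 2 =
        ((b * (totalSpin σ) ^ 2 / (2 * N) : ℝ) : ℂ) := by
      rw [← Complex.ofReal_pow, mul_pow, div_pow, Real.sq_sqrt hb,
        Real.sq_sqrt (Nat.cast_nonneg N)]
      push_cast; ring
    rw [e1] at h
    rw [Complex.exp_add, ← mul_assoc, ← h, ← integral_mul_const]
    congr 1; ext z
    rw [mul_assoc, ← Complex.exp_add]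
    congr 2
    push_cast; ring
  rw [curieWeissTransform, ← mul_div_assoc, Finset.mul_sum, Finset.sum_congr rfl fun σ _ => h2 σ,
    ← integral_finsetSum, ← integral_div]
  · congr 1; ext z
    rw [← Finset.mul_sum, sum_cexp_mul_totalSpin, mul_pow]
    field_simp
  · intro σ _
    have := integrable_cexp_quadratic' (b := -(1 / 2)) (by norm_num)
      (√b / (√(N : ℝ) : ℝ) * totalSpin σ) (θ * Complex.I / (√(N : ℝ) : ℝ) * totalSpin σ)
    convert! this using 2 with z
    rw [← Complex.exp_add]; congr 1; ring

/-- Dominated convergence in the Hubbard–Stratonovich integral: the integrand tends to exp(-z²/2 +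
(√β z + iθ)²/2), which is integrable because β < 1. The inverse temperature may vary with N, as the
annealed one does. -/
lemma tendsto_curieWeissTransform {b : ℕ → ℝ} {β : ℝ} (hb0 : ∀ᶠ N in atTop, 0 ≤ b N)
    (hb : Tendsto b atTop (𝓝 β)) (hβ0 : 0 ≤ β) (hβ1 : β < 1) (θ : ℝ) :
    Tendsto (fun N => curieWeissTransform N (b N) θ) atTop
      (𝓝 ((((Real.pi : ℂ) / (1 / 2)) ^ (1 / 2 : ℂ))⁻¹ *
        (((Real.pi : ℂ) / ((1 - β) / 2)) ^ (1 / 2 : ℂ) *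
        Complex.exp (-(θ ^ 2 / (2 * (1 - β)) : ℝ))))) := by
  have hc0 : ((Real.pi : ℂ) / (1 / 2)) ^ (1 / 2 : ℂ) ≠ 0 := by
    rw [Ne, Complex.cpow_eq_zero_iff]
    simp [Real.pi_ne_zero]
  have hlim : ((Real.pi : ℂ) / ((1 - β) / 2)) ^ (1 / 2 : ℂ) *
        Complex.exp (-(θ ^ 2 / (2 * (1 - β)) : ℝ)) =
      ∫ z : ℝ, Complex.exp (-(z : ℂ) ^ 2 / 2) *
        Complex.exp ((√β * z + θ * Complex.I) ^ 2 / 2) := by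
    have h := integral_cexp_quadratic (b := ((-((1 - β) / 2) : ℝ) : ℂ))
      (by rw [Complex.ofReal_re]; linarith) (√β * θ * Complex.I) (-(θ : ℂ) ^ 2 / 2)
    have hsq : ((√β : ℝ) : ℂ) ^ 2 = β := by
      rw [← Complex.ofReal_pow, Real.sq_sqrt hβ0]
    have h1 : (1 : ℂ) - β ≠ 0 := by
      have : (1 - β : ℝ) ≠ 0 := by linarith
      exact_mod_cast this
    convert! h.symm using 2
    · push_cast; congr 1; ring
    · congr 1
      have : (√β * θ * Complex.I : ℂ) ^ 2 = - (β * θ ^ 2) := by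
        rw [mul_pow, mul_pow, hsq, Complex.I_sq]; ring
      rw [this]; push_cast; field_simp; ring
    · ext z
      rw [← Complex.exp_add]; congr 1
      have : (√β * z + θ * Complex.I : ℂ) ^ 2 =
          β * z ^ 2 + 2 * √β * z * θ * Complex.I - θ ^ 2 := by
        rw [add_sq, mul_pow, mul_pow, hsq, Complex.I_sq]; ring
      rw [this]; push_cast; ring
  suffices h : Tendsto (fun N => ((Real.pi : ℂ) / (1 / 2)) ^ (1 / 2 : ℂ) *
      curieWeissTransform N (b N) θ) atTop (𝓝 (((Real.pi : ℂ) / ((1 - β) / 2)) ^ (1 / 2 : ℂ) *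
        Complex.exp (-(θ ^ 2 / (2 * (1 - β)) : ℝ)))) by
    refine (h.const_mul ((((Real.pi : ℂ) / (1 / 2)) ^ (1 / 2 : ℂ))⁻¹)).congr fun N => ?_
    rw [inv_mul_cancel_left₀ hc0]
  rw [hlim]
  have hcongr : (fun N => ∫ z : ℝ, Complex.exp (-(z : ℂ) ^ 2 / 2) *
        Complex.cosh ((√(b N) * z + θ * Complex.I) / (√(N : ℝ) : ℝ)) ^ N) =ᶠ[atTop]
      (fun N => ((Real.pi : ℂ) / (1 / 2)) ^ (1 / 2 : ℂ) * curieWeissTransform N (b N) θ) := by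
    filter_upwards [hb0] with N hN
    rw [hubbardStratonovich hN]
  refine Tendsto.congr' hcongr ?_
  -- Eventually b N < β' < 1, so cosh x ≤ e^{x²/2} bounds the integrand by the fixed Gaussian
  -- exp(-(1 - β')z²/2).
  set β' : ℝ := (1 + β) / 2 with hβ'
  have hβ'1 : β' < 1 := by rw [hβ']; linarith
  refine tendsto_integral_filter_of_dominated_convergence
    (fun z : ℝ => Real.exp (-((1 - β') / 2) * z ^ 2)) ?_ ?_ ?_ ?_
  · refine Eventually.of_forall fun N => Continuous.aestronglyMeasurable ?_
    have := Complex.continuous_cosh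
    fun_prop
  · filter_upwards [hb0, hb.eventually (gt_mem_nhds (show β < β' by rw [hβ']; linarith)),
      eventually_gt_atTop 0] with N hN0 hN hNpos
    refine Eventually.of_forall fun z => ?_
    rw [norm_mul, norm_pow, Complex.norm_exp]
    have hre : ((√(b N) * z + θ * Complex.I) / (√(N : ℝ) : ℝ) : ℂ).re = √(b N) * z / √N := by
      rw [Complex.div_ofReal_re]; simp
    have hN' : (0 : ℝ) < N := by exact_mod_cast hNpos
    have h1 : ‖Complex.cosh ((√(b N) * z + θ * Complex.I) / (√(N : ℝ) : ℝ))‖ ^ N ≤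
        Real.exp (b N * z ^ 2 / 2) := by
      calc _ ≤ (Real.exp ((√(b N) * z / √N) ^ 2 / 2)) ^ N := by
            gcongr
            refine (norm_cosh_le _).trans ?_
            rw [hre]
            exact Real.cosh_le_exp_half_sq _
        _ = _ := by
            rw [← Real.exp_nat_mul, div_pow, mul_pow, Real.sq_sqrt hN0, Real.sq_sqrt hN'.le]
            congr 1; field_simp
    have hre2 : (-(z : ℂ) ^ 2 / 2).re = -z ^ 2 / 2 := by
      rw [← Complex.ofReal_pow, ← Complex.ofReal_neg]
      norm_cast
    rw [hre2]
    calc _ ≤ Real.exp (-z ^ 2 / 2) * Real.exp (b N * z ^ 2 / 2) := by gcongr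
      _ ≤ _ := by
        rw [← Real.exp_add]
        apply Real.exp_le_exp.2
        nlinarith [sq_nonneg z]
  · exact integrable_exp_neg_mul_sq (by linarith)
  · refine Eventually.of_forall fun z => ?_
    refine Tendsto.const_mul _ (tendsto_cosh_div_sqrt_pow ?_)
    refine Tendsto.add_const _ (Tendsto.mul_const _ ?_)
    exact (Complex.continuous_ofReal.tendsto _).comp
      ((Real.continuous_sqrt.tendsto _).comp hb)

lemma neg_mul_hamiltonian_one {N : ℕ} (b : ℝ) (σ : Config N) :
    -b * hamiltonian 1 (fun _ _ => 1) σ = b * totalSpin σ ^ 2 / (2 * N) := by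
  simp only [hamiltonian, one_mul, sum_spin_mul_spin]
  ring

lemma integral_magnetizationMeasure {E : Type*} [NormedAddCommGroup E] [NormedSpace ℝ E]
    [CompleteSpace E] {N : ℕ} (β p : ℝ) (a : Fin N → Fin N → ℝ) (f : ℝ → E) :
    ∫ x, f x ∂magnetizationMeasure β p a =
      ∑ σ : Config N, gibbsWeight β p a σ • f (scaledMagnetization σ) := by
  rw [magnetizationMeasure, integral_finsetSum_measure]
  · refine Finset.sum_congr rfl fun σ _ => ?_
    rw [integral_smul_measure, integral_dirac,
      ENNReal.toReal_ofReal (gibbsWeight_nonneg β p a σ)]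
  · intro σ _
    exact (integrable_dirac (by simp)).smul_measure ENNReal.ofReal_ne_top

lemma real_magnetizationMeasure {N : ℕ} (β p : ℝ) (a : Fin N → Fin N → ℝ) {s : Set ℝ}
    (hs : MeasurableSet s) :
    (magnetizationMeasure β p a).real s =
      ∑ σ : Config N, s.indicator 1 (scaledMagnetization σ) * gibbsWeight β p a σ := by
  rw [← integral_indicator_one hs, integral_magnetizationMeasure]
  simp [mul_comm]

lemma charFun_curieWeiss {N : ℕ} (b θ : ℝ) :
    charFun (magnetizationMeasure (N := N) b 1 (fun _ _ => 1)) θ =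
      curieWeissTransform N b θ / curieWeissTransform N b 0 := by
  rw [charFun_apply_real, integral_magnetizationMeasure]
  simp only [gibbsWeight, partitionFunction, neg_mul_hamiltonian_one, curieWeissTransform]
  rw [div_div_div_cancel_right₀ (pow_ne_zero N two_ne_zero), Finset.sum_div]
  refine Finset.sum_congr rfl fun σ _ => ?_
  rw [Complex.exp_add, Complex.real_smul, scaledMagnetization]
  push_cast
  simp only [zero_mul, add_zero]
  rw [div_mul_eq_mul_div]
  congr 3
  congr 1
  rw [totalSpin]; push_cast; ring

theorem tendsto_curieWeissLaw {b : ℕ → ℝ} {β : ℝ} (hb0 : ∀ᶠ N in atTop, 0 ≤ b N)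
    (hb : Tendsto b atTop (𝓝 β)) (hβ0 : 0 ≤ β) (hβ1 : β < 1) :
    Tendsto (fun N : ℕ => magnetizationLaw (N := N) (b N) 1 (fun _ _ => 1)) atTop
      (𝓝 (centeredNormal (1 / (1 - β)))) := by
  rw [ProbabilityMeasure.tendsto_iff_tendsto_charFun]
  intro θ
  have h0 : ((Real.pi : ℂ) / (1 / 2)) ^ (1 / 2 : ℂ) ≠ 0 := by
    rw [Ne, Complex.cpow_eq_zero_iff]
    simp [Real.pi_ne_zero]
  have hβ : (1 : ℂ) - β ≠ 0 := by
    have : (1 - β : ℝ) ≠ 0 := by linarith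
    exact_mod_cast this
  have h1 : ((Real.pi : ℂ) / ((1 - β) / 2)) ^ (1 / 2 : ℂ) ≠ 0 := by
    rw [Ne, Complex.cpow_eq_zero_iff]
    simp [Real.pi_ne_zero, hβ]
  -- The characteristic function is the transform at θ over the transform at 0, so the Gaussian
  -- prefactors cancel.
  have h := (tendsto_curieWeissTransform hb0 hb hβ0 hβ1 θ).div
    (tendsto_curieWeissTransform hb0 hb hβ0 hβ1 0) (mul_ne_zero (inv_ne_zero h0) (mul_ne_zero h1 (Complex.exp_ne_zero _)))
  convert! h using 1
  · ext N
    exact charFun_curieWeiss (b N) θ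
  · congr 1
    change charFun (gaussianReal 0 (Real.toNNReal (1 / (1 - β)))) θ = _
    rw [charFun_gaussianReal, Real.coe_toNNReal _ (by simp; linarith)]
    rw [mul_div_mul_left _ _ (inv_ne_zero h0), mul_div_mul_left _ _ h1]
    simp only [ne_eq, OfNat.ofNat_ne_zero, not_false_eq_true, zero_pow, zero_div, neg_zero,
      Complex.ofReal_zero, Complex.exp_zero, div_one]
    congr 1
    push_cast
    field_simp
    ring

theorem tendsto_curieWeissLaw_Iic {b : ℕ → ℝ} {β : ℝ} (hb0 : ∀ᶠ N in atTop, 0 ≤ b N)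
    (hb : Tendsto b atTop (𝓝 β)) (hβ0 : 0 ≤ β) (hβ1 : β < 1) (t : ℝ) :
    Tendsto (fun N : ℕ => (magnetizationMeasure (N := N) (b N) 1 (fun _ _ => 1)).real (Set.Iic t))
      atTop (𝓝 ((centeredNormal (1 / (1 - β)) : Measure ℝ).real (Set.Iic t))) := by
  have hv : Real.toNNReal (1 / (1 - β)) ≠ 0 := by simp; linarith
  have := nullSingletonClass_gaussianReal (μ := 0) hv
  have h := ProbabilityMeasure.tendsto_measure_of_null_frontier_of_tendsto'
    (tendsto_curieWeissLaw hb0 hb hβ0 hβ1) (E := Set.Iic t) (by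
      rw [frontier_Iic]
      exact measure_singleton (μ := gaussianReal 0 (Real.toNNReal (1 / (1 - β)))) t)
  exact (ENNReal.tendsto_toReal (measure_ne_top _ _)).comp h

/-! ### Exponential moments of magnetization and overlap. -/

/-- The normalized Curie–Weiss partition function at inverse temperature `b`. -/
def curieWeissMoment (N : ℕ) (b : ℝ) : ℝ :=
  (∑ σ : Config N, Real.exp (b * totalSpin σ ^ 2 / (2 * N))) / 2 ^ N

/-- The transform at θ = 0 equals this moment. It converges in N, hence is bounded. -/
lemma exists_curieWeissMoment_le {b : ℝ} (hb0 : 0 ≤ b) (hb1 : b < 1) :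
    ∃ C, ∀ N, curieWeissMoment N b ≤ C := by
  have h := tendsto_curieWeissTransform (b := fun _ => b) (Eventually.of_forall fun _ => hb0)
    tendsto_const_nhds hb0 hb1 0
  obtain ⟨C, hC⟩ := h.norm.bddAbove_range
  refine ⟨C, fun N => le_trans (le_of_eq ?_) (hC ⟨N, rfl⟩)⟩
  have : curieWeissTransform N b 0 = (curieWeissMoment N b : ℂ) := by
    simp [curieWeissTransform, curieWeissMoment]
  simp only [this]
  rw [Complex.norm_real, Real.norm_of_nonneg]
  unfold curieWeissMoment; positivity

/-- The unnormalized overlap `∑ i, σ_i τ_i`. -/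
def overlap {N : ℕ} (σ τ : Config N) : ℝ := ∑ i, spin σ i * spin τ i

lemma card_config (N : ℕ) : Fintype.card (Config N) = 2 ^ N := by
  simp [Config]

/-- Gauge symmetry: τ ↦ στ permutes the configurations and turns the overlap with σ into the total
spin. -/
lemma sum_overlap {N : ℕ} (σ : Config N) (f : ℝ → ℝ) :
    ∑ τ, f (overlap σ τ) = ∑ τ : Config N, f (totalSpin τ) := by
  refine Fintype.sum_equiv (Equiv.mulLeft σ) _ _ fun τ => ?_
  simp [overlap, totalSpin, spin]

/-- For the product of two Curie–Weiss measures in the high temperature phase, `exp (q R²) - 1`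
has small expectation whenever `q N` is small, `R` being the overlap. -/
lemma exists_sum_sum_exp_overlap_le {b : ℝ} (hb0 : 0 ≤ b) (hb1 : b < 1) :
    ∃ l > 0, ∃ C, 0 ≤ C ∧ ∀ N : ℕ, ∀ q d : ℝ, 0 ≤ q → q * N ≤ l → 0 ≤ d → 2 * N * d ≤ b →
      ∑ σ : Config N, ∑ τ : Config N, Real.exp (d * totalSpin σ ^ 2) *
        Real.exp (d * totalSpin τ ^ 2) * (Real.exp (q * overlap σ τ ^ 2) - 1) ≤
      C * (q * N) * (∑ σ : Config N, Real.exp (d * totalSpin σ ^ 2)) ^ 2 := by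
  -- As b < s < 1, the temperature b/s is still in the high temperature phase, and a weight 1 - s
  -- remains for the overlap.
  set s : ℝ := (1 + b) / 2 with hs
  have hs0 : 0 < s := by rw [hs]; linarith
  have hs1 : 0 < 1 - s := by rw [hs]; linarith
  have hbs : b / s < 1 := by rw [div_lt_one hs0, hs]; linarith
  obtain ⟨C₁, hC₁⟩ := exists_curieWeissMoment_le (b := b / s) (by positivity) hbs
  obtain ⟨C₂, hC₂⟩ := exists_curieWeissMoment_le (b := 1 / 2) (by norm_num) (by norm_num)
  have hM0 : ∀ N b, 0 ≤ curieWeissMoment N b := fun N b => by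
    unfold curieWeissMoment; positivity
  have hC₂0 : 0 ≤ C₂ := (hM0 0 _).trans (hC₂ 0)
  -- With this l, lR²/N divided by the weight 1 - s is R²/(4N), a Curie–Weiss exponent at inverse
  -- temperature 1/2.
  set l : ℝ := (1 - s) / 4 with hl
  have hl0 : 0 < l := by rw [hl]; positivity
  refine ⟨l, hl0, (s * C₁ ^ 2 + (1 - s) * C₂) / l, by positivity, ?_⟩
  intro N q d hq hqN hd hdN
  rcases Nat.eq_zero_or_pos N with rfl | hN
  · simp [totalSpin, overlap]
  have hN' : (0 : ℝ) < N := by exact_mod_cast hN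
  have hpt : ∀ σ τ : Config N, Real.exp (d * totalSpin σ ^ 2) *
        Real.exp (d * totalSpin τ ^ 2) * (Real.exp (q * overlap σ τ ^ 2) - 1) ≤
      q * N / l * (s * (Real.exp (b / s * totalSpin σ ^ 2 / (2 * N)) *
        Real.exp (b / s * totalSpin τ ^ 2 / (2 * N))) +
        (1 - s) * Real.exp (1 / 2 * overlap σ τ ^ 2 / (2 * N))) := by
    intro σ τ
    have hconv := convexOn_exp.2
    -- Convexity of exp between 0 and lR²/N, with weight qN/l ≤ 1, extracts the small factor qN.
    have h1 : Real.exp (q * overlap σ τ ^ 2) - 1 ≤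
        q * N / l * Real.exp (l * overlap σ τ ^ 2 / N) := by
      have h := hconv (Set.mem_univ (l * overlap σ τ ^ 2 / N)) (Set.mem_univ 0)
        (a := q * N / l) (b := 1 - q * N / l) (by positivity)
        (by rw [sub_nonneg, div_le_one hl0]; exact hqN) (by ring)
      simp only [smul_eq_mul, mul_zero, add_zero, Real.exp_zero, mul_one] at h
      have e : q * N / l * (l * overlap σ τ ^ 2 / N) = q * overlap σ τ ^ 2 := by
        field_simp
      rw [e] at h
      have : 0 ≤ q * N / l := by positivity
      linarith
    -- Convexity with weights s and 1 - s separates magnetizations from overlap, so that each part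
    -- can be summed on its own.
    have h2 : Real.exp (d * totalSpin σ ^ 2) * Real.exp (d * totalSpin τ ^ 2) *
        Real.exp (l * overlap σ τ ^ 2 / N) ≤
        s * (Real.exp (b / s * totalSpin σ ^ 2 / (2 * N)) *
        Real.exp (b / s * totalSpin τ ^ 2 / (2 * N))) +
        (1 - s) * Real.exp (1 / 2 * overlap σ τ ^ 2 / (2 * N)) := by
      have h := hconv (Set.mem_univ (b / s * totalSpin σ ^ 2 / (2 * N) +
        b / s * totalSpin τ ^ 2 / (2 * N))) (Set.mem_univ (1 / 2 * overlap σ τ ^ 2 / (2 * N)))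
        (a := s) (b := 1 - s) hs0.le hs1.le (by ring)
      simp only [smul_eq_mul] at h
      rw [← Real.exp_add, ← Real.exp_add, ← Real.exp_add]
      refine le_trans (Real.exp_le_exp.2 ?_) h
      have hd' : d ≤ b / (2 * N) := by
        rw [le_div_iff₀ (by positivity)]; linarith
      have e1 : s * (b / s * totalSpin σ ^ 2 / (2 * N) + b / s * totalSpin τ ^ 2 / (2 * N)) =
          b / (2 * N) * totalSpin σ ^ 2 + b / (2 * N) * totalSpin τ ^ 2 := by
        field_simp
      have e2 : (1 - s) * (1 / 2 * overlap σ τ ^ 2 / (2 * N)) = l * overlap σ τ ^ 2 / N := by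
        rw [hl]; field_simp; ring
      rw [e1, e2]
      gcongr
    calc _ ≤ Real.exp (d * totalSpin σ ^ 2) * Real.exp (d * totalSpin τ ^ 2) *
          (q * N / l * Real.exp (l * overlap σ τ ^ 2 / N)) := by gcongr
      _ = q * N / l * (Real.exp (d * totalSpin σ ^ 2) * Real.exp (d * totalSpin τ ^ 2) *
          Real.exp (l * overlap σ τ ^ 2 / N)) := by ring
      _ ≤ _ := by gcongr
  -- Every term is at least 1; this replaces the normalization 2^N by the partition function in the
  -- final bound.
  have hZ : (2 : ℝ) ^ N ≤ ∑ σ : Config N, Real.exp (d * totalSpin σ ^ 2) := by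
    have : ∑ σ : Config N, (1 : ℝ) ≤ ∑ σ : Config N, Real.exp (d * totalSpin σ ^ 2) :=
      Finset.sum_le_sum fun σ _ => Real.one_le_exp (by positivity)
    simpa [card_config] using this
  have hsum : ∀ b, ∑ σ : Config N, Real.exp (b * totalSpin σ ^ 2 / (2 * N)) =
      2 ^ N * curieWeissMoment N b := fun b => by
    rw [curieWeissMoment]; field_simp
  have hov : ∀ σ : Config N, ∑ τ, Real.exp (1 / 2 * overlap σ τ ^ 2 / (2 * N)) =
      2 ^ N * curieWeissMoment N (1 / 2) := fun σ => by
    rw [sum_overlap σ fun x => Real.exp (1 / 2 * x ^ 2 / (2 * N)), hsum]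
  calc _ ≤ ∑ σ : Config N, ∑ τ : Config N,
        q * N / l * (s * (Real.exp (b / s * totalSpin σ ^ 2 / (2 * N)) *
        Real.exp (b / s * totalSpin τ ^ 2 / (2 * N))) +
        (1 - s) * Real.exp (1 / 2 * overlap σ τ ^ 2 / (2 * N))) :=
        Finset.sum_le_sum fun σ _ => Finset.sum_le_sum fun τ _ => hpt σ τ
    _ = q * N / l * (s * curieWeissMoment N (b / s) ^ 2 +
        (1 - s) * curieWeissMoment N (1 / 2)) * (2 ^ N) ^ 2 := by
        simp only [← Finset.mul_sum, Finset.sum_add_distrib, ← Finset.sum_mul, hov, hsum]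
        simp only [Finset.sum_const, Finset.card_univ, card_config, nsmul_eq_mul]
        push_cast; ring
    _ ≤ q * N / l * (s * C₁ ^ 2 + (1 - s) * C₂) *
        (∑ σ : Config N, Real.exp (d * totalSpin σ ^ 2)) ^ 2 := by
        have := hM0 N (b / s)
        have := hC₁ N
        have := hC₂ N
        gcongr
    _ = _ := by ring

/-! ### Dilute weights and expectations over the edges. -/

/-- The Gibbs weight without the factor that depends only on the number of edges. -/
def edgeWeight {N : ℕ} (t : ℝ) (a : Fin N → Fin N → ℝ) (σ : Config N) : ℝ :=
  ∏ e : Fin N × Fin N, (1 + t * a e.1 e.2 * (spin σ e.1 * spin σ e.2))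

lemma spin_mul_spin_eq_one_or {N : ℕ} (σ : Config N) (i j : Fin N) :
    spin σ i * spin σ j = 1 ∨ spin σ i * spin σ j = -1 := by
  rcases spin_eq_one_or σ i with h | h <;> rcases spin_eq_one_or σ j with h' | h' <;>
    simp [h, h']

/-- For a ∈ {0, 1} and s = ±1, e^{γas} = cosh(γa)(1 + tanh(γ)·a·s). The cosh factors do not involve
σ and cancel in the Gibbs measure. -/
lemma exp_neg_mul_hamiltonian {N : ℕ} (β p : ℝ) {a : Fin N → Fin N → ℝ}
    (ha : ∀ i j, a i j = 0 ∨ a i j = 1) (σ : Config N) :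
    Real.exp (-β * hamiltonian p a σ) =
      (∏ e : Fin N × Fin N, Real.cosh (β / (2 * N * p) * a e.1 e.2)) *
        edgeWeight (Real.tanh (β / (2 * N * p))) a σ := by
  have h : -β * hamiltonian p a σ = ∑ e : Fin N × Fin N,
      β / (2 * N * p) * a e.1 e.2 * (spin σ e.1 * spin σ e.2) := by
    rw [hamiltonian, Fintype.sum_prod_type, Finset.mul_sum, Finset.mul_sum]
    refine Finset.sum_congr rfl fun i _ => ?_
    rw [Finset.mul_sum, Finset.mul_sum]
    refine Finset.sum_congr rfl fun j _ => ?_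
    ring
  rw [h, Real.exp_sum, edgeWeight, ← Finset.prod_mul_distrib]
  refine Finset.prod_congr rfl fun e _ => ?_
  rcases ha e.1 e.2 with h0 | h1
  · simp [h0]
  · have hc := (Real.cosh_pos (β / (2 * N * p))).ne'
    rw [h1, Real.tanh_eq_sinh_div_cosh]
    rcases spin_mul_spin_eq_one_or σ e.1 e.2 with hs | hs <;> rw [hs]
    · simp only [mul_one]; rw [← Real.cosh_add_sinh]; field_simp
    · simp only [mul_one, mul_neg]; rw [← Real.cosh_sub_sinh]; field_simp; ring

lemma gibbsWeight_eq_edgeWeight_div {N : ℕ} (β p : ℝ) {a : Fin N → Fin N → ℝ}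
    (ha : ∀ i j, a i j = 0 ∨ a i j = 1) (σ : Config N) :
    gibbsWeight β p a σ = edgeWeight (Real.tanh (β / (2 * N * p))) a σ /
      ∑ τ : Config N, edgeWeight (Real.tanh (β / (2 * N * p))) a τ := by
  simp only [gibbsWeight, partitionFunction, exp_neg_mul_hamiltonian β p ha, ← Finset.mul_sum]
  exact mul_div_mul_left _ _ (Finset.prod_pos fun e _ => Real.cosh_pos _).ne'

namespace IsDirectedErdosRenyi

variable {Ω : Type*} [MeasurableSpace Ω] {P : Measure Ω} [IsProbabilityMeasure P] {N : ℕ} {p : ℝ}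
    {ε : Fin N → Fin N → Ω → ℝ}

lemma ae_eq_zero_or_one (h : IsDirectedErdosRenyi P p ε) :
    ∀ᵐ ω ∂P, ∀ i j, ε i j ω = 0 ∨ ε i j ω = 1 := by
  refine ae_all_iff.2 fun i => ae_all_iff.2 fun j => ?_
  have h0 : MeasurableSet {ω | ε i j ω = 0} := h.measurable i j (measurableSet_singleton 0)
  have h1 : MeasurableSet {ω | ε i j ω = 1} := h.measurable i j (measurableSet_singleton 1)
  have hd : Disjoint {ω | ε i j ω = 0} {ω | ε i j ω = 1} := by
    rw [Set.disjoint_left]; intro ω h h'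
    simp only [Set.mem_ofPred_eq] at h h'
    rw [h] at h'; exact zero_ne_one h'
  have hu : P.real ({ω | ε i j ω = 0} ∪ {ω | ε i j ω = 1}) = 1 := by
    rw [measureReal_union hd h1, h.prob_zero, h.prob_one]; ring
  have hu' : P ({ω | ε i j ω = 0} ∪ {ω | ε i j ω = 1}) = 1 := by
    rw [measureReal_def] at hu
    exact (ENNReal.toReal_eq_one_iff _).1 hu
  exact (mem_ae_iff_prob_eq_one (h0.union h1)).2 hu'

lemma integral_comp (h : IsDirectedErdosRenyi P p ε) (i j : Fin N) (f : ℝ → ℝ) :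
    ∫ ω, f (ε i j ω) ∂P = f 0 * (1 - p) + f 1 * p := by
  have h1 : MeasurableSet {ω | ε i j ω = 1} := h.measurable i j (measurableSet_singleton 1)
  have hae : (fun ω => f (ε i j ω)) =ᵐ[P]
      fun ω => f 0 + (f 1 - f 0) * {ω | ε i j ω = 1}.indicator (fun _ => 1) ω := by
    filter_upwards [h.ae_eq_zero_or_one] with ω hω
    rcases hω i j with h' | h' <;> simp [Set.indicator, h']
  rw [integral_congr_ae hae, integral_add (integrable_const _)
    (((integrable_const (1 : ℝ)).indicator h1).const_mul _), integral_const_mul,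
    integral_indicator_const _ h1, h.prob_one]
  simp; ring

lemma integral_prod_comp (h : IsDirectedErdosRenyi P p ε) (f : Fin N × Fin N → ℝ → ℝ)
    (hf : ∀ e, Measurable (f e)) :
    ∫ ω, ∏ e : Fin N × Fin N, f e (ε e.1 e.2 ω) ∂P =
      ∏ e : Fin N × Fin N, (f e 0 * (1 - p) + f e 1 * p) := by
  rw [h.indep.integral_fun_prod_comp (fun e => (h.measurable e.1 e.2).aemeasurable)
    fun e => (hf e).aestronglyMeasurable]
  exact Finset.prod_congr rfl fun e _ => h.integral_comp e.1 e.2 (f e)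

lemma memLp_edgeWeight (h : IsDirectedErdosRenyi P p ε) (t : ℝ) (σ : Config N) :
    MemLp (fun ω => edgeWeight t (fun i j => ε i j ω) σ) 2 P := by
  refine MemLp.of_bound (C := ∏ e : Fin N × Fin N, (1 + |t|)) ?_ ?_
  · have := h.measurable
    unfold edgeWeight
    exact Measurable.aestronglyMeasurable (by fun_prop)
  · filter_upwards [h.ae_eq_zero_or_one] with ω hω
    rw [edgeWeight, norm_prod]
    refine Finset.prod_le_prod (fun _ _ => norm_nonneg _) fun e _ => ?_
    refine (norm_add_le _ _).trans ?_
    rcases spin_mul_spin_eq_one_or σ e.1 e.2 with hs | hs <;>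
    rcases hω e.1 e.2 with h' | h' <;> simp [hs, h']

end IsDirectedErdosRenyi

/-! ### Annealed weights and correlations of two configurations. -/

lemma one_add_mul_eq_sqrt_mul_exp {x s : ℝ} (hx : x ∈ Set.Ioo (-1 : ℝ) 1) (hs : s = 1 ∨ s = -1) :
    1 + x * s = √(1 - x ^ 2) * Real.exp (Real.artanh x * s) := by
  have h : √(1 - x ^ 2) ≠ 0 := (Real.sqrt_pos.2 (by nlinarith [hx.1, hx.2])).ne'
  rcases hs with rfl | rfl
  · rw [mul_one, mul_one, ← Real.cosh_add_sinh, Real.cosh_artanh hx, Real.sinh_artanh hx]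
    field_simp
  · rw [mul_neg_one, mul_neg_one, ← Real.cosh_sub_sinh, Real.cosh_artanh hx, Real.sinh_artanh hx]
    field_simp; ring

/-- The expectation of `edgeWeight`, which is a Curie–Weiss weight. -/
def meanWeight {N : ℕ} (x : ℝ) (σ : Config N) : ℝ :=
  √(1 - x ^ 2) ^ (N * N) * Real.exp (Real.artanh x * totalSpin σ ^ 2)

lemma prod_one_add_mul_spin {N : ℕ} {x : ℝ} (hx : x ∈ Set.Ioo (-1 : ℝ) 1) (σ : Config N) :
    ∏ e : Fin N × Fin N, (1 + x * (spin σ e.1 * spin σ e.2)) = meanWeight x σ := by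
  rw [Finset.prod_congr rfl fun e _ =>
    one_add_mul_eq_sqrt_mul_exp hx (spin_mul_spin_eq_one_or σ e.1 e.2), Finset.prod_mul_distrib,
    ← Real.exp_sum, ← Finset.mul_sum, Fintype.sum_prod_type, sum_spin_mul_spin, meanWeight]
  simp

lemma meanWeight_pos {N : ℕ} {x : ℝ} (hx : x ∈ Set.Ioo (-1 : ℝ) 1) (σ : Config N) :
    0 < meanWeight x σ := by
  have h : 0 < √(1 - x ^ 2) := Real.sqrt_pos.2 (by nlinarith [hx.1, hx.2])
  unfold meanWeight; positivity

/-- The coefficient of the squared overlap in the bound for the correlation of two weights. -/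
def overlapCoeff (p t : ℝ) : ℝ := p * t ^ 2 * (1 - p) / (1 - (p * t) ^ 2) ^ 2

lemma overlapCoeff_nonneg {p t : ℝ} (hp0 : 0 ≤ p) (hp1 : p ≤ 1) : 0 ≤ overlapCoeff p t := by
  have : 0 ≤ 1 - p := by linarith
  unfold overlapCoeff; positivity

/-- Put x = pt. The left side is (1 + xs)(1 + xs') + pt²(1 - p)ss'. As s² = 1, (1 + xs)(s - x) = (1
- x²)s, so it equals (1 + xs)(1 + xs')(1 + q(s - x)(s' - x)) exactly. Then 1 + y ≤ e^y. -/
lemma edge_correlation_le {p t s s' : ℝ} (hx : p * t ∈ Set.Ioo (-1 : ℝ) 1)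
    (hs : s = 1 ∨ s = -1) (hs' : s' = 1 ∨ s' = -1) :
    1 * (1 - p) + (1 + t * s) * (1 + t * s') * p ≤
      (1 + p * t * s) * (1 + p * t * s') *
        Real.exp (overlapCoeff p t * (s * s' - p * t * (s + s') + (p * t) ^ 2)) := by
  set x := p * t with hxdef
  set q := overlapCoeff p t with hq
  have hx2 : 1 - x ^ 2 ≠ 0 := by nlinarith [hx.1, hx.2]
  have hqx : q * (1 - x ^ 2) ^ 2 = p * t ^ 2 * (1 - p) := by
    rw [hq, overlapCoeff, ← hxdef]; field_simp
  have hpos : ∀ u : ℝ, u = 1 ∨ u = -1 → 0 < 1 + x * u := by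
    rintro u (rfl | rfl) <;> linarith [hx.1, hx.2]
  calc 1 * (1 - p) + (1 + t * s) * (1 + t * s') * p
      = (1 + x * s) * (1 + x * s') * (q * (s * s' - x * (s + s') + x ^ 2) + 1) := by
        rcases hs with rfl | rfl <;> rcases hs' with rfl | rfl
        · linear_combination -hqx
        · linear_combination hqx
        · linear_combination hqx
        · linear_combination -hqx
    _ ≤ _ := by
        have := hpos s hs
        have := hpos s' hs'
        gcongr
        exact Real.add_one_le_exp _

namespace IsDirectedErdosRenyi

variable {Ω : Type*} [MeasurableSpace Ω] {P : Measure Ω} [IsProbabilityMeasure P] {N : ℕ} {p : ℝ}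
    {ε : Fin N → Fin N → Ω → ℝ}

lemma integral_edgeWeight (h : IsDirectedErdosRenyi P p ε) {t : ℝ}
    (hx : p * t ∈ Set.Ioo (-1 : ℝ) 1) (σ : Config N) :
    ∫ ω, edgeWeight t (fun i j => ε i j ω) σ ∂P = meanWeight (p * t) σ := by
  rw [← prod_one_add_mul_spin hx]
  refine (h.integral_prod_comp (fun e x => 1 + t * x * (spin σ e.1 * spin σ e.2))
    fun e => by fun_prop).trans ?_
  refine Finset.prod_congr rfl fun e _ => ?_
  ring

/-- Independence reduces the expectation to the one-edge bound. Summed over edges, the exponents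
give the squared overlap, the constant qx²N² with x = pt, and a term in the magnetizations that is
nonpositive and dropped. -/
lemma integral_edgeWeight_mul_le (h : IsDirectedErdosRenyi P p ε) {t : ℝ} (hp0 : 0 ≤ p)
    (hp1 : p ≤ 1) (hx : p * t ∈ Set.Ico (0 : ℝ) 1) (ht : |t| ≤ 1) (σ τ : Config N) :
    ∫ ω, edgeWeight t (fun i j => ε i j ω) σ * edgeWeight t (fun i j => ε i j ω) τ ∂P ≤
      meanWeight (p * t) σ * meanWeight (p * t) τ *
        Real.exp (overlapCoeff p t * overlap σ τ ^ 2 +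
          overlapCoeff p t * (p * t) ^ 2 * N ^ 2) := by
  have hx' : p * t ∈ Set.Ioo (-1 : ℝ) 1 := ⟨by linarith [hx.1], hx.2⟩
  have hq := overlapCoeff_nonneg (t := t) hp0 hp1
  set q := overlapCoeff p t
  -- Nonnegative factors, needed to multiply the one-edge inequalities; this is where |t| ≤ 1
  -- enters.
  have hf (σ : Config N) (e : Fin N × Fin N) : 0 ≤ 1 + t * (spin σ e.1 * spin σ e.2) := by
    rcases spin_mul_spin_eq_one_or σ e.1 e.2 with hs | hs <;> rw [hs] <;>
      linarith [abs_le.1 ht]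
  have h1 := h.integral_prod_comp (fun e x => (1 + t * x * (spin σ e.1 * spin σ e.2)) *
    (1 + t * x * (spin τ e.1 * spin τ e.2))) fun e => by fun_prop
  simp only [edgeWeight, ← Finset.prod_mul_distrib]
  rw [h1]
  have hsum : ∑ e : Fin N × Fin N, q * ((spin σ e.1 * spin σ e.2) * (spin τ e.1 * spin τ e.2) -
      p * t * (spin σ e.1 * spin σ e.2 + spin τ e.1 * spin τ e.2) + (p * t) ^ 2) =
      q * (overlap σ τ ^ 2 - p * t * (totalSpin σ ^ 2 + totalSpin τ ^ 2) +
        (p * t) ^ 2 * N ^ 2) := by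
    have ho : ∑ e : Fin N × Fin N, (spin σ e.1 * spin σ e.2) * (spin τ e.1 * spin τ e.2) =
        overlap σ τ ^ 2 := by
      rw [overlap, sq, Finset.sum_mul_sum, Fintype.sum_prod_type]
      exact Finset.sum_congr rfl fun i _ => Finset.sum_congr rfl fun j _ => by ring
    have hS (σ : Config N) : ∑ e : Fin N × Fin N, spin σ e.1 * spin σ e.2 = totalSpin σ ^ 2 := by
      rw [Fintype.sum_prod_type, sum_spin_mul_spin]
    rw [← Finset.mul_sum, Finset.sum_add_distrib, Finset.sum_sub_distrib, ← Finset.mul_sum,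
      Finset.sum_add_distrib, ho, hS, hS]
    simp; left; ring
  calc _ ≤ ∏ e : Fin N × Fin N, ((1 + p * t * (spin σ e.1 * spin σ e.2)) *
        (1 + p * t * (spin τ e.1 * spin τ e.2)) *
        Real.exp (q * ((spin σ e.1 * spin σ e.2) * (spin τ e.1 * spin τ e.2) -
          p * t * (spin σ e.1 * spin σ e.2 + spin τ e.1 * spin τ e.2) + (p * t) ^ 2))) := by
        refine Finset.prod_le_prod (fun e _ => ?_) fun e _ => ?_
        · have := mul_nonneg (mul_nonneg (hf σ e) (hf τ e)) hp0
          simp only [mul_one, mul_zero, zero_mul, add_zero]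
          linarith
        · refine le_of_eq_of_le ?_ (edge_correlation_le hx'
            (spin_mul_spin_eq_one_or σ e.1 e.2) (spin_mul_spin_eq_one_or τ e.1 e.2))
          ring
    _ = meanWeight (p * t) σ * meanWeight (p * t) τ *
        Real.exp (q * (overlap σ τ ^ 2 - p * t * (totalSpin σ ^ 2 + totalSpin τ ^ 2) +
        (p * t) ^ 2 * N ^ 2)) := by
        rw [Finset.prod_mul_distrib, Finset.prod_mul_distrib, ← Real.exp_sum, hsum,
          prod_one_add_mul_spin hx', prod_one_add_mul_spin hx']
    _ ≤ _ := by
        have := meanWeight_pos hx' σ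
        have := meanWeight_pos hx' τ
        gcongr
        have : 0 ≤ q * (p * t * (totalSpin σ ^ 2 + totalSpin τ ^ 2)) := by
          have := hx.1
          positivity
        linarith

/-- If two independent copies of the annealed model have almost uncorrelated weights, then the
random partition function restricted by `f` is concentrated. -/
lemma variance_le (h : IsDirectedErdosRenyi P p ε) {t : ℝ} (hp0 : 0 ≤ p)
    (hp1 : p ≤ 1) (hx : p * t ∈ Set.Ico (0 : ℝ) 1) (ht : |t| ≤ 1) {v : ℝ}
    (hv : ∑ σ : Config N, ∑ τ : Config N, meanWeight (p * t) σ * meanWeight (p * t) τ *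
        (Real.exp (overlapCoeff p t * overlap σ τ ^ 2 +
          overlapCoeff p t * (p * t) ^ 2 * N ^ 2) - 1) ≤
      v * (∑ σ : Config N, meanWeight (p * t) σ) ^ 2)
    {f : Config N → ℝ} (hf : ∀ σ, f σ ∈ Set.Icc (0 : ℝ) 1) :
    variance (fun ω => ∑ σ, f σ * edgeWeight t (fun i j => ε i j ω) σ) P ≤
      v * (∑ σ : Config N, meanWeight (p * t) σ) ^ 2 := by
  have hx' : p * t ∈ Set.Ioo (-1 : ℝ) 1 := ⟨by linarith [hx.1], hx.2⟩
  have hm := h.memLp_edgeWeight t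
  have hW : MemLp (fun ω => ∑ σ, f σ * edgeWeight t (fun i j => ε i j ω) σ) 2 P :=
    memLp_finsetSum _ fun σ _ => (hm σ).const_mul _
  have hint (σ τ : Config N) : Integrable (fun ω => edgeWeight t (fun i j => ε i j ω) σ *
      edgeWeight t (fun i j => ε i j ω) τ) P := (hm σ).integrable_mul (hm τ)
  have h1 : ∫ ω, (∑ σ, f σ * edgeWeight t (fun i j => ε i j ω) σ) ^ 2 ∂P =
      ∑ σ, ∑ τ, f σ * f τ * ∫ ω, edgeWeight t (fun i j => ε i j ω) σ *
        edgeWeight t (fun i j => ε i j ω) τ ∂P := by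
    have : ∀ ω, (∑ σ, f σ * edgeWeight t (fun i j => ε i j ω) σ) ^ 2 =
        ∑ σ, ∑ τ, f σ * f τ * (edgeWeight t (fun i j => ε i j ω) σ *
        edgeWeight t (fun i j => ε i j ω) τ) := fun ω => by
      rw [sq, Finset.sum_mul_sum]
      exact Finset.sum_congr rfl fun i _ => Finset.sum_congr rfl fun j _ => by ring
    simp_rw [this]
    rw [integral_finsetSum _ fun σ _ => integrable_finsetSum _ fun τ _ => (hint σ τ).const_mul _]
    refine Finset.sum_congr rfl fun σ _ => ?_
    rw [integral_finsetSum _ fun τ _ => (hint σ τ).const_mul _]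
    simp_rw [integral_const_mul]
  have h2 : ∫ ω, (∑ σ, f σ * edgeWeight t (fun i j => ε i j ω) σ) ∂P =
      ∑ σ, f σ * meanWeight (p * t) σ := by
    rw [integral_finsetSum _ fun σ _ => ((hm σ).integrable (by norm_num)).const_mul _]
    simp_rw [integral_const_mul, h.integral_edgeWeight hx']
  rw [variance_eq_sub hW]
  simp only [Pi.pow_apply]
  rw [h1, h2, sq (∑ σ, f σ * meanWeight (p * t) σ), Finset.sum_mul_sum, ← Finset.sum_sub_distrib]
  refine le_trans (Finset.sum_le_sum fun σ _ => ?_) hv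
  rw [← Finset.sum_sub_distrib]
  refine Finset.sum_le_sum fun τ _ => ?_
  have hle := h.integral_edgeWeight_mul_le hp0 hp1 hx ht σ τ
  have hff : f σ * f τ ∈ Set.Icc (0 : ℝ) 1 :=
    ⟨mul_nonneg (hf σ).1 (hf τ).1, mul_le_one₀ (hf σ).2 (hf τ).1 (hf τ).2⟩
  have hexp : 1 ≤ Real.exp (overlapCoeff p t * overlap σ τ ^ 2 +
          overlapCoeff p t * (p * t) ^ 2 * N ^ 2) := by
    have := overlapCoeff_nonneg (t := t) hp0 hp1
    exact Real.one_le_exp (by positivity)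
  -- The bound on each covariance is nonnegative, so the weight f σ * f τ ≤ 1 can be discarded
  -- termwise, whatever the sign of the covariance.
  have hnn : 0 ≤ meanWeight (p * t) σ * meanWeight (p * t) τ *
      (Real.exp (overlapCoeff p t * overlap σ τ ^ 2 +
          overlapCoeff p t * (p * t) ^ 2 * N ^ 2) - 1) :=
    mul_nonneg (mul_pos (meanWeight_pos hx' σ) (meanWeight_pos hx' τ)).le (by linarith)
  have h3 := mul_le_mul_of_nonneg_left hle hff.1
  have h4 := mul_le_mul_of_nonneg_right hff.2 hnn
  linarith

end IsDirectedErdosRenyi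

/-! ### Concentration of Gibbs probabilities around the Curie–Weiss ones. -/

lemma real_curieWeiss_eq {x : ℝ} (hx : x ∈ Set.Ioo (-1 : ℝ) 1) (hN : 0 < N) {s : Set ℝ}
    (hs : MeasurableSet s) :
    (magnetizationMeasure (N := N) (2 * N * Real.artanh x) 1 (fun _ _ => 1)).real s =
      (∑ σ : Config N, s.indicator 1 (scaledMagnetization σ) * meanWeight x σ) /
        ∑ σ : Config N, meanWeight x σ := by
  have hN' : (0 : ℝ) < N := by exact_mod_cast hN
  have hc : √(1 - x ^ 2) ^ (N * N) ≠ 0 :=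
    (pow_pos (Real.sqrt_pos.2 (by nlinarith [hx.1, hx.2])) _).ne'
  have he (σ : Config N) : 2 * N * Real.artanh x * totalSpin σ ^ 2 / (2 * N) =
      Real.artanh x * totalSpin σ ^ 2 := by field_simp
  rw [real_magnetizationMeasure _ _ _ hs, Finset.sum_div]
  refine Finset.sum_congr rfl fun σ _ => ?_
  simp only [gibbsWeight, partitionFunction, neg_mul_hamiltonian_one, he, meanWeight,
    ← Finset.mul_sum]
  rw [mul_div_assoc, mul_div_mul_left _ _ hc]

lemma abs_div_sub_le {a b c η : ℝ} (hη : η < 1) (ha : |a - c| ≤ η) (hb : |b - 1| ≤ η)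
    (hc : c ∈ Set.Icc (0 : ℝ) 1) : |a / b - c| ≤ 2 * η / (1 - η) := by
  have hη0 : 0 ≤ η := (abs_nonneg _).trans ha
  have hb1 : 1 - η ≤ b := by linarith [(abs_le.1 hb).1]
  have hb0 : 0 < b := by linarith
  have e : a / b - c = ((a - c) - c * (b - 1)) / b := by field_simp; ring
  rw [e, abs_div, abs_of_pos hb0]
  have : |(a - c) - c * (b - 1)| ≤ 2 * η := by
    refine (abs_sub _ _).trans ?_
    rw [abs_mul, abs_of_nonneg hc.1]
    have := mul_le_mul hc.2 hb (abs_nonneg _) zero_le_one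
    linarith
  have : 0 < 1 - η := by linarith
  gcongr

namespace IsDirectedErdosRenyi

variable {Ω : Type*} [MeasurableSpace Ω] {P : Measure Ω} [IsProbabilityMeasure P] {N : ℕ} {p : ℝ}
    {ε : Fin N → Fin N → Ω → ℝ}

/-- A Gibbs probability is a ratio of two random sums. Chebyshev keeps each within η·m of its mean,
m being the annealed partition function; the two exceptional events give the factor 2, and
`abs_div_sub_le` transfers the bounds to the ratio. -/
lemma measure_lt_abs_sub_curieWeiss_le (h : IsDirectedErdosRenyi P p ε) {β : ℝ} (hN : 0 < N)
    (hp0 : 0 ≤ p) (hp1 : p ≤ 1)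
    (hx : p * Real.tanh (β / (2 * N * p)) ∈ Set.Ico (0 : ℝ) 1) {v : ℝ}
    (hv : ∑ σ : Config N, ∑ τ : Config N, meanWeight (p * Real.tanh (β / (2 * N * p))) σ *
        meanWeight (p * Real.tanh (β / (2 * N * p))) τ *
        (Real.exp (overlapCoeff p (Real.tanh (β / (2 * N * p))) * overlap σ τ ^ 2 +
          overlapCoeff p (Real.tanh (β / (2 * N * p))) *
            (p * Real.tanh (β / (2 * N * p))) ^ 2 * N ^ 2) - 1) ≤
      v * (∑ σ : Config N, meanWeight (p * Real.tanh (β / (2 * N * p))) σ) ^ 2)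
    {s : Set ℝ} (hs : MeasurableSet s) {η : ℝ} (hη0 : 0 < η) (hη1 : η < 1) :
    P {ω | 2 * η / (1 - η) < |(magnetizationMeasure β p (fun i j => ε i j ω)).real s -
      (magnetizationMeasure (N := N) (2 * N * Real.artanh (p * Real.tanh (β / (2 * N * p)))) 1
        (fun _ _ => 1)).real s|} ≤ 2 * ENNReal.ofReal (v / η ^ 2) := by
  set t := Real.tanh (β / (2 * N * p)) with ht
  have ht1 : |t| ≤ 1 := (Real.abs_tanh_lt_one _).le
  have hx' : p * t ∈ Set.Ioo (-1 : ℝ) 1 := ⟨by linarith [hx.1], hx.2⟩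
  set m := ∑ σ : Config N, meanWeight (p * t) σ with hmdef
  have hm : 0 < m := Finset.sum_pos (fun σ _ => meanWeight_pos hx' σ) Finset.univ_nonempty
  have cheb : ∀ f : Config N → ℝ, (∀ σ, f σ ∈ Set.Icc (0 : ℝ) 1) →
      P {ω | η * m ≤ |∑ σ, f σ * edgeWeight t (fun i j => ε i j ω) σ -
        ∑ σ, f σ * meanWeight (p * t) σ|} ≤ ENNReal.ofReal (v / η ^ 2) := by
    intro f hf
    have hW : MemLp (fun ω => ∑ σ, f σ * edgeWeight t (fun i j => ε i j ω) σ) 2 P :=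
      memLp_finsetSum _ fun σ _ => (h.memLp_edgeWeight t σ).const_mul _
    have h2 : ∫ ω, (∑ σ, f σ * edgeWeight t (fun i j => ε i j ω) σ) ∂P =
        ∑ σ, f σ * meanWeight (p * t) σ := by
      rw [integral_finsetSum _ fun σ _ =>
        ((h.memLp_edgeWeight t σ).integrable (by norm_num)).const_mul _]
      simp_rw [integral_const_mul, h.integral_edgeWeight hx']
    have hc := meas_ge_le_variance_div_sq hW (c := η * m) (by positivity)
    rw [h2] at hc
    refine hc.trans (ENNReal.ofReal_le_ofReal ?_)
    rw [mul_pow, ← div_div, div_le_iff₀ (by positivity), div_mul_eq_mul_div]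
    gcongr
    exact h.variance_le hp0 hp1 hx ht1 hv hf
  have hi : ∀ σ : Config N, s.indicator (1 : ℝ → ℝ) (scaledMagnetization σ) ∈
      Set.Icc (0 : ℝ) 1 := fun σ => by
    by_cases hσ : scaledMagnetization σ ∈ s <;> simp [hσ]
  have c1 := cheb _ hi
  have c2 := cheb (fun _ => 1) fun _ => by simp
  simp only [one_mul] at c2
  rw [two_mul (ENNReal.ofReal _)]
  refine le_trans (measure_mono_ae ?_) ((measure_union_le _ _).trans (add_le_add c1 c2))
  -- The passage to `edgeWeight` needs indicators equal to 0 or 1, which holds only almost surely.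
  filter_upwards [h.ae_eq_zero_or_one] with ω hω hmem
  by_contra hcon
  replace hcon : |∑ σ, s.indicator (1 : ℝ → ℝ) (scaledMagnetization σ) *
      edgeWeight t (fun i j => ε i j ω) σ -
      ∑ σ, s.indicator (1 : ℝ → ℝ) (scaledMagnetization σ) * meanWeight (p * t) σ| < η * m ∧
      |∑ σ, edgeWeight t (fun i j => ε i j ω) σ - ∑ σ, meanWeight (p * t) σ| < η * m :=
    ⟨lt_of_not_ge fun h1 => hcon (Or.inl h1), lt_of_not_ge fun h2 => hcon (Or.inr h2)⟩
  have hmem' : 2 * η / (1 - η) < _ := hmem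
  refine hmem'.not_ge ?_
  rw [real_magnetizationMeasure _ _ _ hs, real_curieWeiss_eq hx' hN hs]
  simp only [gibbsWeight_eq_edgeWeight_div β p hω]
  rw [← ht]
  simp only [← mul_div_assoc]
  rw [← Finset.sum_div]
  set A := ∑ σ, s.indicator (1 : ℝ → ℝ) (scaledMagnetization σ) *
    edgeWeight t (fun i j => ε i j ω) σ
  set B := ∑ σ, edgeWeight t (fun i j => ε i j ω) σ
  set C := ∑ σ, s.indicator (1 : ℝ → ℝ) (scaledMagnetization σ) * meanWeight (p * t) σ with hC
  rw [← hmdef]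
  rw [← hmdef] at hcon
  rw [← div_div_div_cancel_right₀ hm.ne' A B]
  refine abs_div_sub_le hη1 ?_ ?_ ⟨?_, ?_⟩
  · rw [← sub_div, abs_div, abs_of_pos hm, div_le_iff₀ hm]; exact hcon.1.le
  · rw [div_sub_one hm.ne', abs_div, abs_of_pos hm, div_le_iff₀ hm]; exact hcon.2.le
  · exact div_nonneg (Finset.sum_nonneg fun σ _ =>
      mul_nonneg (hi σ).1 (meanWeight_pos hx' σ).le) hm.le
  · rw [div_le_one hm]
    refine Finset.sum_le_sum fun σ _ => ?_
    exact mul_le_of_le_one_left (meanWeight_pos hx' σ).le (hi σ).2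

end IsDirectedErdosRenyi

/-! ### First-order expansions of tanh and artanh at 0. -/

lemma tendsto_mul_comp_of_hasDerivAt {g : ℝ → ℝ} {c : ℝ} (hg : HasDerivAt g c 0) (hg0 : g 0 = 0)
    {u w : ℕ → ℝ} {l : ℝ} (hu : Tendsto u atTop (𝓝 0))
    (hwu : Tendsto (fun n => w n * u n) atTop (𝓝 l)) :
    Tendsto (fun n => w n * g (u n)) atTop (𝓝 (l * c)) := by
  have hφ : Tendsto (dslope g 0) (𝓝 0) (𝓝 c) := by
    have := (continuousAt_dslope_same.2 hg.differentiableAt).tendsto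
    rwa [dslope_same, hg.deriv] at this
  refine (hwu.mul (hφ.comp hu)).congr fun n => ?_
  have h := sub_smul_dslope g 0 (u n)
  rw [hg0, sub_zero, sub_zero, smul_eq_mul] at h
  rw [Function.comp_apply, mul_assoc, h]

lemma hasDerivAt_artanh_zero : HasDerivAt Real.artanh 1 0 := by
  have h1 : HasDerivAt (fun x : ℝ => (1 + x) / (1 - x)) 2 0 := by
    have := ((hasDerivAt_id (0 : ℝ)).const_add 1).div ((hasDerivAt_id (0 : ℝ)).const_sub 1)
      (by simp)
    convert! this using 1
    norm_num
  have h2 := (h1.log (by simp)).const_mul (1 / 2 : ℝ)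
  have h3 : HasDerivAt (fun x : ℝ => 1 / 2 * Real.log ((1 + x) / (1 - x))) 1 0 := by
    convert! h2 using 1; norm_num
  refine h3.congr_of_eventuallyEq ?_
  filter_upwards [Icc_mem_nhds (show (-1 : ℝ) < 0 by norm_num) (show (0 : ℝ) < 1 by norm_num)]
    with x hx using Real.artanh_eq_half_log hx

lemma hasDerivAt_tanh_zero : HasDerivAt Real.tanh 1 0 := by
  have h := (Real.hasDerivAt_sinh 0).div (Real.hasDerivAt_cosh 0) (Real.cosh_pos 0).ne'
  have e : Real.tanh = Real.sinh / Real.cosh := by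
    ext x; exact Real.tanh_eq_sinh_div_cosh x
  rw [e]
  convert! h using 1
  simp

/-! ### Lévy distance from a finite grid. -/

/-- Closeness of the distribution functions on a fine finite grid controls the Lévy distance. -/
lemma exists_finset_levyDist_le (μ₂ : ProbabilityMeasure ℝ) {δ : ℝ} (hδ : 0 < δ) :
    ∃ T : Finset ℝ, ∀ μ₁ : ProbabilityMeasure ℝ,
      (∀ t ∈ T, |(μ₁ : Measure ℝ).real (Set.Iic t) - (μ₂ : Measure ℝ).real (Set.Iic t)| ≤ δ / 2) →
      levyDist μ₁ μ₂ ≤ δ := by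
  have hcdf (x : ℝ) : cdf (μ₂ : Measure ℝ) x = (μ₂ : Measure ℝ).real (Set.Iic x) := by
    rw [cdf_eq_real]
  have hbot := tendsto_cdf_atBot (μ₂ : Measure ℝ)
  have htop := tendsto_cdf_atTop (μ₂ : Measure ℝ)
  simp only [funext hcdf] at hbot htop
  -- Outside [A, B] the distribution function of `μ₂` is within δ/2 of 0 or 1. Inside, a grid of
  -- mesh δ suffices, as the Lévy metric allows a horizontal shift by δ.
  obtain ⟨A, hA⟩ := (hbot.eventually (gt_mem_nhds (show (0 : ℝ) < δ / 2 by positivity))).exists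
  obtain ⟨B, hB, hAB⟩ := ((htop.eventually (lt_mem_nhds
    (show 1 - δ / 2 < (1 : ℝ) by linarith))).and (eventually_gt_atTop A)).exists
  obtain ⟨n, hn⟩ := exists_nat_ge ((B - A) / δ)
  have hn' : B ≤ A + n * δ := by
    rw [div_le_iff₀ hδ] at hn; linarith
  refine ⟨(Finset.range (n + 1)).image fun k : ℕ => A + k * δ, fun μ₁ hμ => ?_⟩
  have hgrid : ∀ k : ℕ, k ≤ n → |(μ₁ : Measure ℝ).real (Set.Iic (A + k * δ)) -
      (μ₂ : Measure ℝ).real (Set.Iic (A + k * δ))| ≤ δ / 2 := fun k hk =>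
    hμ _ (Finset.mem_image.2 ⟨k, Finset.mem_range.2 (by omega), rfl⟩)
  have mono (μ : ProbabilityMeasure ℝ) {x y : ℝ} (hxy : x ≤ y) :
      (μ : Measure ℝ).real (Set.Iic x) ≤ (μ : Measure ℝ).real (Set.Iic y) :=
    measureReal_mono (Set.Iic_subset_Iic.2 hxy)
  have le_one (μ : ProbabilityMeasure ℝ) (x : ℝ) : (μ : Measure ℝ).real (Set.Iic x) ≤ 1 :=
    measureReal_le_one
  have nonneg (μ : ProbabilityMeasure ℝ) (x : ℝ) : 0 ≤ (μ : Measure ℝ).real (Set.Iic x) :=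
    measureReal_nonneg
  refine csInf_le ⟨0, fun x hx => hx.1.le⟩ ⟨hδ, fun t => ?_⟩
  rcases lt_or_ge t A with htA | htA
  · have h0 := abs_le.1 (hgrid 0 (Nat.zero_le _))
    simp only [Nat.cast_zero, zero_mul, add_zero] at h0
    constructor
    · linarith [mono μ₁ (show t - δ ≤ A by linarith), nonneg μ₂ t, h0.2]
    · linarith [mono μ₂ htA.le, nonneg μ₁ (t + δ)]
  rcases le_or_gt (A + n * δ) t with htB | htB
  · have hn2 := abs_le.1 (hgrid n le_rfl)
    have hB2 := mono μ₂ hn'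
    constructor
    · linarith [mono μ₂ htB, le_one μ₁ (t - δ)]
    · linarith [mono μ₁ (show A + n * δ ≤ t + δ by linarith), le_one μ₂ t, hn2.1]
  · obtain ⟨k, hk⟩ : ∃ k : ℕ, ⌊(t - A) / δ⌋₊ = k := ⟨_, rfl⟩
    have hnn : 0 ≤ (t - A) / δ := div_nonneg (by linarith) hδ.le
    have hk1 : A + k * δ ≤ t := by
      have := Nat.floor_le hnn
      rw [hk, le_div_iff₀ hδ] at this; linarith
    have hk2 : t < A + (k + 1) * δ := by
      have := Nat.lt_floor_add_one ((t - A) / δ)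
      rw [hk, div_lt_iff₀ hδ] at this; linarith
    have hkn : k < n := by
      have : (k : ℝ) * δ < n * δ := by linarith
      exact_mod_cast lt_of_mul_lt_mul_right this hδ.le
    have g1 := abs_le.1 (hgrid k hkn.le)
    have g2 := abs_le.1 (hgrid (k + 1) hkn)
    push_cast at g2
    constructor
    · linarith [mono μ₁ (show t - δ ≤ A + k * δ by linarith), mono μ₂ hk1, g1.2]
    · linarith [mono μ₁ (show A + (k + 1) * δ ≤ t + δ by linarith), mono μ₂ hk2.le, g2.1]

/-! ### Asymptotics of the couplings and of the variance bound. -/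

/-- Splits e^{qR² + r} - 1 = e^r(e^{qR²} - 1) + (e^r - 1); the common prefactor of the annealed
weights is pulled out of the sums. -/
lemma sum_sum_meanWeight_le {N : ℕ} {x q r D : ℝ}
    (h : ∑ σ : Config N, ∑ τ : Config N, Real.exp (Real.artanh x * totalSpin σ ^ 2) *
        Real.exp (Real.artanh x * totalSpin τ ^ 2) * (Real.exp (q * overlap σ τ ^ 2) - 1) ≤
      D * (∑ σ : Config N, Real.exp (Real.artanh x * totalSpin σ ^ 2)) ^ 2) :
    ∑ σ : Config N, ∑ τ : Config N, meanWeight x σ * meanWeight x τ *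
        (Real.exp (q * overlap σ τ ^ 2 + r) - 1) ≤
      (Real.exp r * D + (Real.exp r - 1)) * (∑ σ : Config N, meanWeight x σ) ^ 2 := by
  set K := √(1 - x ^ 2) ^ (N * N) with hK
  have hsplit (σ τ : Config N) : meanWeight x σ * meanWeight x τ *
        (Real.exp (q * overlap σ τ ^ 2 + r) - 1) =
      K ^ 2 * Real.exp r * (Real.exp (Real.artanh x * totalSpin σ ^ 2) *
        Real.exp (Real.artanh x * totalSpin τ ^ 2) * (Real.exp (q * overlap σ τ ^ 2) - 1)) +
      (Real.exp r - 1) * (meanWeight x σ * meanWeight x τ) := by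
    rw [Real.exp_add, meanWeight, meanWeight]; ring
  have hm : ∑ σ : Config N, meanWeight x σ =
      K * ∑ σ : Config N, Real.exp (Real.artanh x * totalSpin σ ^ 2) := by
    rw [Finset.mul_sum]; rfl
  simp only [hsplit, Finset.sum_add_distrib, ← Finset.mul_sum]
  rw [← Finset.sum_mul, add_mul, sq (∑ σ : Config N, meanWeight x σ)]
  refine add_le_add ?_ le_rfl
  calc _ ≤ K ^ 2 * Real.exp r *
        (D * (∑ σ : Config N, Real.exp (Real.artanh x * totalSpin σ ^ 2)) ^ 2) := by gcongr
    _ = _ := by rw [hm]; ring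

lemma tendsto_coupling {p : ℕ → ℝ} (hpN : Tendsto (fun N : ℕ => p N * (N : ℝ)) atTop atTop)
    (β : ℝ) : Tendsto (fun N : ℕ => β / (2 * N * p N)) atTop (𝓝 0) := by
  have := hpN.inv_tendsto_atTop.const_mul (β / 2)
  rw [mul_zero] at this
  refine this.congr fun N => ?_
  simp only [Pi.inv_apply]
  rw [div_eq_mul_inv, div_eq_mul_inv, mul_inv, mul_inv, mul_inv]; ring

lemma tendsto_tanh_coupling {p : ℕ → ℝ}
    (hpN : Tendsto (fun N : ℕ => p N * (N : ℝ)) atTop atTop) (β : ℝ) :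
    Tendsto (fun N : ℕ => Real.tanh (β / (2 * N * p N))) atTop (𝓝 0) := by
  have := hasDerivAt_tanh_zero.continuousAt.tendsto
  rw [Real.tanh_zero] at this
  exact this.comp (tendsto_coupling hpN β)

lemma tendsto_mul_tanh_coupling {p : ℕ → ℝ}
    (hpN : Tendsto (fun N : ℕ => p N * (N : ℝ)) atTop atTop) (β : ℝ) :
    Tendsto (fun N : ℕ => p N * N * Real.tanh (β / (2 * N * p N))) atTop (𝓝 (β / 2)) := by
  rw [← mul_one (β / 2)]
  refine tendsto_mul_comp_of_hasDerivAt hasDerivAt_tanh_zero Real.tanh_zero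
    (tendsto_coupling hpN β) (tendsto_const_nhds.congr' ?_)
  filter_upwards [hpN.eventually_gt_atTop 0] with N hN
  have h1 : p N ≠ 0 := left_ne_zero_of_mul hN.ne'
  have h2 : (N : ℝ) ≠ 0 := right_ne_zero_of_mul hN.ne'
  field_simp

lemma tendsto_annealed_coupling {p : ℕ → ℝ} (hp : ∀ N, 0 < p N ∧ p N ≤ 1)
    (hpN : Tendsto (fun N : ℕ => p N * (N : ℝ)) atTop atTop) (β : ℝ) :
    Tendsto (fun N : ℕ => p N * Real.tanh (β / (2 * N * p N))) atTop (𝓝 0) := by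
  refine squeeze_zero_norm (fun N => ?_) ((tendsto_tanh_coupling hpN β).norm.trans (by simp))
  rw [norm_mul, Real.norm_of_nonneg (hp N).1.le]
  exact mul_le_of_le_one_left (norm_nonneg _) (hp N).2

/-- To first order artanh(p·tanh(β/(2Np))) is β/(2N), so the annealed inverse temperature tends to
β. -/
lemma tendsto_two_mul_mul_artanh {p : ℕ → ℝ} (hp : ∀ N, 0 < p N ∧ p N ≤ 1)
    (hpN : Tendsto (fun N : ℕ => p N * (N : ℝ)) atTop atTop) (β : ℝ) :
    Tendsto (fun N : ℕ => 2 * N * Real.artanh (p N * Real.tanh (β / (2 * N * p N)))) atTop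
      (𝓝 β) := by
  rw [← mul_one β]
  refine tendsto_mul_comp_of_hasDerivAt (u := fun N : ℕ => p N * Real.tanh (β * 1 / (2 * N * p N)))
    (w := fun N : ℕ => 2 * (N : ℝ)) hasDerivAt_artanh_zero Real.artanh_zero
    (tendsto_annealed_coupling hp hpN _) ?_
  have := (tendsto_mul_tanh_coupling hpN β).const_mul 2
  rw [mul_div_cancel₀ _ two_ne_zero] at this
  rw [mul_one]
  refine this.congr fun N => by ring

/-- Up to a factor tending to 1, qN is at most (pNt)·t, where pNt → β/2 and t → 0 because pN → ∞. -/
lemma tendsto_overlapCoeff_mul {p : ℕ → ℝ} (hp : ∀ N, 0 < p N ∧ p N ≤ 1)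
    (hpN : Tendsto (fun N : ℕ => p N * (N : ℝ)) atTop atTop) (β : ℝ) :
    Tendsto (fun N : ℕ => overlapCoeff (p N) (Real.tanh (β / (2 * N * p N))) * N) atTop
      (𝓝 0) := by
  have hx := tendsto_annealed_coupling hp hpN β
  have h1 : Tendsto (fun N : ℕ => ((1 - (p N * Real.tanh (β / (2 * N * p N))) ^ 2) ^ 2)⁻¹)
      atTop (𝓝 1) := by
    have := (((hx.pow 2).const_sub 1).pow 2).inv₀ (by simp)
    simpa using this
  have h2 := ((tendsto_mul_tanh_coupling hpN β).mul (tendsto_tanh_coupling hpN β)).mul h1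
  rw [mul_zero, zero_mul] at h2
  refine squeeze_zero (fun N => ?_) (fun N => ?_) h2
  · have := overlapCoeff_nonneg (t := Real.tanh (β / (2 * N * p N))) (hp N).1.le (hp N).2
    positivity
  · set t := Real.tanh (β / (2 * N * p N))
    have := (hp N).1
    have h3 : 0 ≤ p N * N * t ^ 2 * ((1 - (p N * t) ^ 2) ^ 2)⁻¹ := by positivity
    have h4 : overlapCoeff (p N) t * N =
        (1 - p N) * (p N * N * t ^ 2 * ((1 - (p N * t) ^ 2) ^ 2)⁻¹) := by
      rw [overlapCoeff, div_eq_mul_inv]; ring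
    rw [h4]
    calc _ ≤ 1 * (p N * N * t ^ 2 * ((1 - (p N * t) ^ 2) ^ 2)⁻¹) := by gcongr; linarith
      _ = _ := by ring

/-! ### Convergence of the distribution functions in probability, and conclusion. -/

lemma tendsto_measure_Iic {Ω : ℕ → Type*} [∀ N, MeasurableSpace (Ω N)]
    (P : ∀ N, Measure (Ω N)) [∀ N, IsProbabilityMeasure (P N)]
    (p : ℕ → ℝ) (hp : ∀ N, 0 < p N ∧ p N ≤ 1)
    (hpN : Tendsto (fun N : ℕ => p N * (N : ℝ)) atTop atTop)
    (ε : ∀ N : ℕ, Fin N → Fin N → Ω N → ℝ)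
    (hε : ∀ N, IsDirectedErdosRenyi (P N) (p N) (ε N))
    (β : ℝ) (hβ0 : 0 < β) (hβ1 : β < 1) (u : ℝ) {κ : ℝ} (hκ : 0 < κ) :
    Tendsto (fun N : ℕ => P N {ω : Ω N |
        κ < |(magnetizationMeasure β (p N) (fun i j => ε N i j ω)).real (Set.Iic u) -
          (centeredNormal (1 / (1 - β)) : Measure ℝ).real (Set.Iic u)|}) atTop (𝓝 0) := by
  have ht0 : ∀ N : ℕ, 0 ≤ Real.tanh (β / (2 * N * p N)) := fun N => by
    have := (hp N).1
    rw [Real.tanh_eq_sinh_div_cosh]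
    exact div_nonneg (Real.sinh_nonneg_iff.2 (by positivity)) (Real.cosh_pos _).le
  have hx : ∀ N : ℕ, p N * Real.tanh (β / (2 * N * p N)) ∈ Set.Ico (0 : ℝ) 1 := fun N =>
    ⟨mul_nonneg (hp N).1.le (ht0 N),
      (mul_le_of_le_one_left (ht0 N) (hp N).2).trans_lt (Real.tanh_lt_one _)⟩
  have hd0 : ∀ N : ℕ, 0 ≤ Real.artanh (p N * Real.tanh (β / (2 * N * p N))) := fun N =>
    Real.artanh_nonneg (hx N).1
  have hb := tendsto_two_mul_mul_artanh hp hpN β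
  have hqN := tendsto_overlapCoeff_mul hp hpN β
  -- Factor as (qN)·(pNt)·(pt), with limits 0, β/2 and 0.
  have hr : Tendsto (fun N : ℕ => overlapCoeff (p N) (Real.tanh (β / (2 * N * p N))) *
      (p N * Real.tanh (β / (2 * N * p N))) ^ 2 * N ^ 2) atTop (𝓝 0) := by
    have := (hqN.mul (tendsto_mul_tanh_coupling hpN β)).mul (tendsto_annealed_coupling hp hpN β)
    rw [mul_zero] at this
    exact this.congr fun N => by ring
  -- The annealed inverse temperature only converges to β, so the overlap bound is taken at (1 +
  -- β)/2, strictly between β and 1.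
  obtain ⟨l, hl, C, -, hCb⟩ := exists_sum_sum_exp_overlap_le (b := (1 + β) / 2) (by linarith)
    (by linarith)
  have hCW := tendsto_curieWeissLaw_Iic (Eventually.of_forall fun N =>
    mul_nonneg (by positivity) (hd0 N)) hb hβ0.le hβ1 u
  -- Solves 2η/(1 - η) = κ/2; the other half of κ pays for the distance from Curie–Weiss to the
  -- normal law.
  set η : ℝ := κ / (4 + κ) with hη
  have hη0 : 0 < η := by positivity
  have hη1 : η < 1 := by rw [hη, div_lt_one (by positivity)]; linarith
  have hηκ : 2 * η / (1 - η) = κ / 2 := by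
    have h1 : 1 - η = 4 / (4 + κ) := by rw [hη]; field_simp; ring
    rw [h1, hη]; field_simp; ring
  have hv : Tendsto (fun N : ℕ => 2 * ENNReal.ofReal
      ((Real.exp (overlapCoeff (p N) (Real.tanh (β / (2 * N * p N))) *
        (p N * Real.tanh (β / (2 * N * p N))) ^ 2 * N ^ 2) *
        (C * (overlapCoeff (p N) (Real.tanh (β / (2 * N * p N))) * N)) +
        (Real.exp (overlapCoeff (p N) (Real.tanh (β / (2 * N * p N))) *
        (p N * Real.tanh (β / (2 * N * p N))) ^ 2 * N ^ 2) - 1)) / η ^ 2)) atTop (𝓝 0) := by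
    have hexp := (Real.continuous_exp.tendsto 0).comp hr
    rw [Real.exp_zero] at hexp
    have h1 := ((hexp.mul (hqN.const_mul C)).add (hexp.sub_const 1)).div_const (η ^ 2)
    have h2 := ENNReal.Tendsto.const_mul (ENNReal.tendsto_ofReal h1) (a := 2)
      (Or.inr ENNReal.ofNat_ne_top)
    simpa using h2
  refine tendsto_of_tendsto_of_tendsto_of_le_of_le' tendsto_const_nhds hv
    (Eventually.of_forall fun _ => zero_le) ?_
  filter_upwards [eventually_gt_atTop 0, hqN.eventually (ge_mem_nhds hl),
    hb.eventually (ge_mem_nhds (show β < (1 + β) / 2 by linarith)),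
    (tendsto_iff_norm_sub_tendsto_zero.1 hCW).eventually
      (ge_mem_nhds (show 0 < κ / 2 by positivity))] with N hN hql hbl hcl
  refine le_trans (measure_mono fun ω hω => ?_)
    ((hε N).measure_lt_abs_sub_curieWeiss_le hN (hp N).1.le (hp N).2 (hx N)
      (sum_sum_meanWeight_le (hCb N _ _
        (overlapCoeff_nonneg (hp N).1.le (hp N).2) hql (hd0 N) hbl))
      (measurableSet_Iic (a := u)) hη0 hη1)
  have hω' : κ < _ := hω
  change 2 * η / (1 - η) < _
  rw [hηκ]
  rw [Real.norm_eq_abs] at hcl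
  have := hω'.trans_le (abs_sub_le _ ((magnetizationMeasure (N := N)
    (2 * N * Real.artanh (p N * Real.tanh (β / (2 * N * p N)))) 1
        (fun _ _ => 1)).real (Set.Iic u)) _)
  linarith

end DiluteIsing

end

theorem theorem1p1 {Ω : ℕ → Type*} [∀ N, MeasurableSpace (Ω N)]
    (P : ∀ N, Measure (Ω N)) [∀ N, IsProbabilityMeasure (P N)]
    (p : ℕ → ℝ) (hp : ∀ N, 0 < p N ∧ p N ≤ 1)
    (hpN : Tendsto (fun N : ℕ => p N * (N : ℝ)) atTop atTop)
    (ε : ∀ N : ℕ, Fin N → Fin N → Ω N → ℝ)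
    (hε : ∀ N, DiluteIsing.IsDirectedErdosRenyi (P N) (p N) (ε N))
    (β : ℝ) (hβ0 : 0 < β) (hβ1 : β < 1) :
    ∀ δ : ℝ, 0 < δ →
      Tendsto (fun N : ℕ => P N {ω : Ω N |
          DiluteIsing.levyDist (DiluteIsing.magnetizationLaw β (p N) (fun i j => ε N i j ω))
            (DiluteIsing.centeredNormal (1 / (1 - β))) > δ})
        atTop (𝓝 0) := by
  intro δ hδ
  obtain ⟨T, hT⟩ := DiluteIsing.exists_finset_levyDist_le
    (DiluteIsing.centeredNormal (1 / (1 - β))) hδ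
  -- The grid depends only on the limit law and δ, so a union bound over this fixed finite set
  -- preserves convergence to 0.
  have hsum := tendsto_finsetSum T fun u _ =>
    DiluteIsing.tendsto_measure_Iic P p hp hpN ε hε β hβ0 hβ1 u (half_pos hδ)
  rw [Finset.sum_const_zero] at hsum
  refine tendsto_of_tendsto_of_tendsto_of_le_of_le tendsto_const_nhds hsum
    (fun _ => zero_le) fun N => ?_
  refine le_trans (measure_mono fun ω hω => ?_) (measure_biUnion_finset_le T _)
  by_contra hcon
  refine (not_lt.2 (hT (DiluteIsing.magnetizationLaw β (p N) (fun i j => ε N i j ω))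
    fun u hu => ?_)) hω
  by_contra hu'
  exact hcon (Set.mem_biUnion hu (not_le.1 hu'))
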